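/- For integers $n,k\ge 0$, let ${n \brace k}_{\ge 2}$ be the number of set partitions of an $n$-element set into exactly $k$ nonempty blocks, each containing at least $2$ elements, and let $$B_{n,\ge 2}=\sum_{k=0}^{n}{n \brace k}_{\ge 2}$$ be the associated Bell number, i.e. the number of set partitions of an $n$-element set with no singleton block (so $B_{0,\ge 2}=1$ and $B_{1,\ge 2}=0$). The Hankel transform of a sequence $(a_n)_{n\ge 0}$ is the sequence of determinants $\det\,[a_{i+j}]_{0\le i,j\le n}$, $n\ge 0$. **Theorem.** The Hankel transform of the associated Bell numbers $B_{n,\ge 2}$ is the sequence of superfactorials; that is, for every integer $n\ge 0$, $$\det\,[B_{i+j,\ge 2}]_{0\le i,j\le n}=\prod_{i=0}^{n} i!.$$ -/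

import Mathlib

open scoped Nat

/-- The associated Stirling number of the second kind: the number of set partitions of an
`n`-element set into exactly `k` (nonempty) blocks, each having at least `m` elements. -/
def associatedStirlingSecond (m n k : ℕ) : ℕ :=
  (Finset.univ.filter fun P : Finpartition (Finset.univ : Finset (Fin n)) =>
    P.parts.card = k ∧ ∀ b ∈ P.parts, m ≤ b.card).card

/-- The associated Bell number `B_{n, ≥ m}`: the sum over `0 ≤ k ≤ n` of the associated Stirling
numbers of the second kind. -/
def associatedBell (m n : ℕ) : ℕ :=
  ∑ k ∈ Finset.range (n + 1), associatedStirlingSecond m n k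

/-- The Hankel matrix of order `n` of a sequence `a`: the `(n + 1) × (n + 1)` matrix with
entries `a (i + j)`, `0 ≤ i, j ≤ n`. -/
def hankelMatrix (a : ℕ → ℤ) (n : ℕ) : Matrix (Fin (n + 1)) (Fin (n + 1)) ℤ :=
  Matrix.of fun i j => a ((i : ℕ) + (j : ℕ))

/-- The Hankel transform of a sequence `a`: the sequence of determinants of its Hankel
matrices. -/
def hankelTransform (a : ℕ → ℤ) (n : ℕ) : ℤ :=
  (hankelMatrix a n).det

/-! Deleting the block of a marked point gives `B (n+1) = ∑ k < n, C(n,k) B k`. For the functional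
`L` with `L(X^n) = B n` this says `L((X+1) p(X)) = L(p(X+1))`. The shifted Charlier polynomials `C
n` are built so that `L(C (n+1) * q) = L(C n * Δq)`, where `Δ` is the forward difference; hence `L(C
n * X^j)` is `0` for `j < n` and `n!` for `j = n`. As `C n` is monic of degree `n`, a unitriangular
row change makes the Hankel matrix upper triangular with diagonal `i!`. -/

/-! ### Recurrence for the associated Bell numbers -/

/-- The set partitions of `s` without singleton blocks, as families of blocks. -/
def nonsingletonPartitions {α : Type*} [DecidableEq α] (s : Finset α) :
    Finset (Finset (Finset α)) :=
  s.powerset.powerset.filter fun Q =>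
    (∀ b ∈ Q, 2 ≤ b.card) ∧ ∀ x ∈ s, ∃ b ∈ Q, x ∈ b ∧ ∀ c ∈ Q, x ∈ c → c = b

theorem mem_nonsingletonPartitions {α : Type*} [DecidableEq α] {s : Finset α}
    {Q : Finset (Finset α)} :
    Q ∈ nonsingletonPartitions s ↔ (∀ b ∈ Q, b ⊆ s) ∧ (∀ b ∈ Q, 2 ≤ b.card) ∧
      ∀ x ∈ s, ∃ b ∈ Q, x ∈ b ∧ ∀ c ∈ Q, x ∈ c → c = b := by
  simp [nonsingletonPartitions, Finset.subset_iff (s₁ := Q)]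

/-- Families of blocks keep one type when the ground set shrinks, unlike `Finpartition s`. -/
theorem associatedBell_two_eq_card (n : ℕ) :
    associatedBell 2 n = (nonsingletonPartitions (Finset.univ : Finset (Fin n))).card := by
  have h : associatedBell 2 n = (Finset.univ.filter
      fun P : Finpartition (Finset.univ : Finset (Fin n)) => ∀ b ∈ P.parts, 2 ≤ b.card).card := by
    rw [Finset.card_eq_sum_card_fiberwise (f := fun P => P.parts.card)
      (t := Finset.range (n + 1))]
    · refine Finset.sum_congr rfl fun k _ => ?_
      rw [associatedStirlingSecond, Finset.filter_filter]
      simp only [and_comm]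
    · intro P _
      have := P.card_parts_le_card
      simp only [Finset.card_univ, Fintype.card_fin] at this
      simpa [Nat.lt_succ_iff] using this
  rw [h]
  refine Finset.card_bij (fun P _ => P.parts) ?_ ?_ ?_
  · intro P hP
    rw [mem_nonsingletonPartitions]
    refine ⟨fun b _ => Finset.subset_univ b, (Finset.mem_filter.1 hP).2, fun x hx => ?_⟩
    obtain ⟨b, hb, hxb⟩ := P.exists_mem hx
    exact ⟨b, hb, hxb, fun c hc hxc => P.eq_of_mem_parts hc hb hxc hxb⟩
  · intro P _ P' _ hPP'
    exact Finpartition.ext hPP'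
  · intro Q hQ
    obtain ⟨h1, h2, h3⟩ := mem_nonsingletonPartitions.1 hQ
    refine ⟨Finpartition.ofExistsUnique Q h1 (fun x hx => ?_) (fun h0 => ?_), ?_, rfl⟩
    · obtain ⟨b, hb, hxb, hu⟩ := h3 x hx
      exact ⟨b, ⟨hb, hxb⟩, fun c hc => hu c hc.1 hc.2⟩
    · simpa using h2 _ h0
    · simpa using h2

theorem nonsingletonPartitions_empty {α : Type*} [DecidableEq α] :
    nonsingletonPartitions (∅ : Finset α) = {∅} := by
  ext Q
  rw [mem_nonsingletonPartitions, Finset.mem_singleton]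
  constructor
  · rintro ⟨h1, h2, -⟩
    refine Finset.eq_empty_of_forall_notMem fun b hb => ?_
    have := h2 b hb
    simp [Finset.subset_empty.1 (h1 b hb)] at this
  · rintro rfl
    simp

/-- Splitting a set partition of `insert a s` along the complement `u` of the block of `a`. -/
theorem card_nonsingletonPartitions_insert {α : Type*} [DecidableEq α] {s : Finset α} {a : α}
    (ha : a ∉ s) :
    (nonsingletonPartitions (insert a s)).card =
      ∑ u ∈ s.ssubsets, (nonsingletonPartitions u).card := by
  rw [← Finset.card_sigma]
  symm
  have key : ∀ x ∈ s.ssubsets.sigma fun u => nonsingletonPartitions u,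
      x.1 ⊂ s ∧ a ∉ x.1 ∧ insert a s \ x.1 ∉ x.2 ∧
        ∀ b ∈ insert (insert a s \ x.1) x.2, a ∈ b → b = insert a s \ x.1 := by
    rintro ⟨u, Q⟩ hx
    rw [Finset.mem_sigma, Finset.mem_ssubsets, mem_nonsingletonPartitions] at hx
    obtain ⟨hu, h1, -, -⟩ := hx
    have hau : a ∉ u := fun h => ha (hu.1 h)
    refine ⟨hu, hau, fun h => hau (h1 _ h (by simp [hau])), fun b hb hab => ?_⟩
    rcases Finset.mem_insert.1 hb with rfl | hb
    · rfl
    · exact absurd (h1 b hb hab) hau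
  refine Finset.card_bij (fun x _ => insert (insert a s \ x.1) x.2) ?_ ?_ ?_
  · rintro ⟨u, Q⟩ hx
    obtain ⟨hu, hau, -, hblock⟩ := key _ hx
    rw [Finset.mem_sigma, Finset.mem_ssubsets, mem_nonsingletonPartitions] at hx
    obtain ⟨-, h1, h2, h3⟩ := hx
    dsimp only at *
    rw [mem_nonsingletonPartitions]
    refine ⟨?_, ?_, fun x hx => ?_⟩
    · intro b hb
      rcases Finset.mem_insert.1 hb with rfl | hb
      · exact Finset.sdiff_subset
      · exact (h1 b hb).trans (hu.1.trans (Finset.subset_insert _ _))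
    · intro b hb
      rcases Finset.mem_insert.1 hb with rfl | hb
      -- Since `u` is proper in `s`, the block of `a` has a second element.
      · obtain ⟨y, hys, hyu⟩ := Finset.exists_of_ssubset hu
        have hay : a ≠ y := fun h => ha (h ▸ hys)
        rw [← Finset.card_pair hay]
        refine Finset.card_le_card fun z hz => ?_
        rcases Finset.mem_insert.1 hz with rfl | hz
        · simp [hau]
        · rw [Finset.mem_singleton.1 hz]
          simp [hys, hyu]
      · exact h2 b hb
    · by_cases hxu : x ∈ u
      · obtain ⟨b, hb, hxb, huniq⟩ := h3 x hxu
        refine ⟨b, Finset.mem_insert_of_mem hb, hxb, fun c hc hxc => ?_⟩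
        rcases Finset.mem_insert.1 hc with rfl | hc
        · exact absurd hxu (Finset.mem_sdiff.1 hxc).2
        · exact huniq c hc hxc
      · refine ⟨_, Finset.mem_insert_self _ _, Finset.mem_sdiff.2 ⟨hx, hxu⟩, fun c hc hxc => ?_⟩
        rcases Finset.mem_insert.1 hc with rfl | hc
        · rfl
        · exact absurd (h1 c hc hxc) hxu
  · rintro ⟨u, Q⟩ hx ⟨u', Q'⟩ hx' heq
    obtain ⟨hu, hau, hQ, hblock⟩ := key _ hx
    obtain ⟨hu', hau', hQ', hblock'⟩ := key _ hx'
    dsimp only at *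
    have hb : insert a s \ u = insert a s \ u' :=
      hblock' _ (heq ▸ Finset.mem_insert_self _ _) (by simp [hau])
    have huu : u = u' := by
      rw [← Finset.sdiff_sdiff_eq_self (hu.1.trans (Finset.subset_insert a s)), hb,
        Finset.sdiff_sdiff_eq_self (hu'.1.trans (Finset.subset_insert a s))]
    subst huu
    rw [← Finset.erase_insert hQ, heq, Finset.erase_insert hQ']
  · intro P hP
    obtain ⟨h1, h2, h3⟩ := mem_nonsingletonPartitions.1 hP
    obtain ⟨b, hb, hab, hbu⟩ := h3 a (Finset.mem_insert_self a s)
    have hsub := h1 b hb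
    have hmem : ∀ {c x}, c ∈ P → c ≠ b → x ∈ c → x ∉ b := by
      intro c x hc hcb hxc hxb
      obtain ⟨d, -, -, hdu⟩ := h3 x (hsub hxb)
      exact hcb ((hdu c hc hxc).trans (hdu b hb hxb).symm)
    refine ⟨⟨insert a s \ b, P.erase b⟩, ?_, ?_⟩
    · rw [Finset.mem_sigma, Finset.mem_ssubsets, mem_nonsingletonPartitions]
      refine ⟨?_, fun c hc => ?_, fun c hc => h2 c (Finset.mem_of_mem_erase hc), fun x hx => ?_⟩
      · obtain ⟨y, hyb, hya⟩ := Finset.exists_mem_ne (h2 b hb) a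
        have hys : y ∈ s := (Finset.mem_insert.1 (hsub hyb)).resolve_left hya
        refine (Finset.ssubset_iff_of_subset fun x hx => ?_).2 ⟨y, hys, by simp [hyb]⟩
        obtain ⟨hx, hxb⟩ := Finset.mem_sdiff.1 hx
        exact (Finset.mem_insert.1 hx).resolve_left fun h => hxb (h ▸ hab)
      · obtain ⟨hcb, hc⟩ := Finset.mem_erase.1 hc
        exact fun x hx => Finset.mem_sdiff.2 ⟨h1 c hc hx, hmem hc hcb hx⟩
      · obtain ⟨hx, hxb⟩ := Finset.mem_sdiff.1 hx
        obtain ⟨c, hc, hxc, hcu⟩ := h3 x hx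
        exact ⟨c, Finset.mem_erase.2 ⟨fun h => hxb (h ▸ hxc), hc⟩, hxc,
          fun d hd => hcu d (Finset.mem_of_mem_erase hd)⟩
    · dsimp only
      rw [Finset.sdiff_sdiff_eq_self hsub, Finset.insert_erase hb]

/-- The numbers determined by `V 0 = 1` and `V (n + 1) = ∑ k < n, n.choose k * V k`. -/
def bellNonsingleton : ℕ → ℕ
  | 0 => 1
  | n + 1 => ∑ k : Fin n, n.choose k * bellNonsingleton k

theorem bellNonsingleton_zero : bellNonsingleton 0 = 1 := by
  rw [bellNonsingleton]

theorem bellNonsingleton_succ (n : ℕ) :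
    bellNonsingleton (n + 1) = ∑ k ∈ Finset.range n, n.choose k * bellNonsingleton k := by
  rw [bellNonsingleton, Finset.sum_range]

theorem card_nonsingletonPartitions {α : Type*} [DecidableEq α] (s : Finset α) :
    (nonsingletonPartitions s).card = bellNonsingleton s.card := by
  induction s using Finset.strongInduction with
  | H s ih =>
    rcases s.eq_empty_or_nonempty with rfl | ⟨a, ha⟩
    · simp [nonsingletonPartitions_empty, bellNonsingleton_zero]
    · have hna := Finset.notMem_erase a s
      have hss := Finset.erase_ssubset ha
      have hcard : s.card = (s.erase a).card + 1 := (Finset.card_erase_add_one ha).symm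
      conv_lhs => rw [← Finset.insert_erase ha]
      rw [card_nonsingletonPartitions_insert hna, hcard, bellNonsingleton_succ,
        Finset.sum_congr rfl fun u hu => ih u ((Finset.mem_ssubsets.1 hu).trans hss)]
      -- The top term, `u = s.erase a`, would leave the block `{a}`; it is cancelled from both
      -- sides.
      have h := Finset.sum_powerset_apply_card bellNonsingleton (x := s.erase a)
      rw [Finset.sum_range_succ, Nat.choose_self, one_smul, ← Finset.sum_erase_add _ _
        (Finset.mem_powerset_self (s.erase a)), add_left_inj] at h
      simpa [Finset.ssubsets] using h

theorem associatedBell_two_zero : associatedBell 2 0 = 1 := by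
  rw [associatedBell_two_eq_card, card_nonsingletonPartitions, Finset.card_univ,
    Fintype.card_fin, bellNonsingleton_zero]

theorem associatedBell_two_succ (n : ℕ) :
    associatedBell 2 (n + 1) = ∑ k ∈ Finset.range n, n.choose k * associatedBell 2 k := by
  simp only [associatedBell_two_eq_card, card_nonsingletonPartitions, Finset.card_univ,
    Fintype.card_fin, bellNonsingleton_succ]

/-! ### Orthogonality of the shifted Charlier polynomials -/

open Polynomial in
/-- The linear functional on polynomials whose moments are a given sequence. -/
noncomputable def momentFunctional (a : ℕ → ℤ) : ℤ[X] →ₗ[ℤ] ℤ :=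
  Polynomial.lsum fun n => a n • LinearMap.id

open Polynomial in
theorem momentFunctional_X_pow (a : ℕ → ℤ) (n : ℕ) : momentFunctional a (X ^ n) = a n := by
  rw [momentFunctional, Polynomial.lsum_apply, ← Polynomial.monomial_one_right_eq_X_pow,
    Polynomial.sum_monomial_index _ _ (by simp)]
  simp

open Polynomial in
theorem momentFunctional_eq_sum (a : ℕ → ℤ) {p : ℤ[X]} {n : ℕ} (hp : p.natDegree < n) :
    momentFunctional a p = ∑ k ∈ Finset.range n, p.coeff k * a k := by
  rw [momentFunctional, Polynomial.lsum_apply, Polynomial.sum_over_range' _ (by simp) n hp]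
  simp [mul_comm]

-- By linearity `p = X ^ n` suffices; the summand `1` in `X + 1` supplies the term `k = n` absent
-- from the recurrence.
open Polynomial in
theorem momentFunctional_X_add_one_mul {a : ℕ → ℤ}
    (ha : ∀ n, a (n + 1) = ∑ k ∈ Finset.range n, n.choose k * a k) (p : ℤ[X]) :
    momentFunctional a ((X + 1) * p) = momentFunctional a (taylor 1 p) := by
  suffices h : (momentFunctional a).comp (LinearMap.mulLeft ℤ (X + 1)) =
      (momentFunctional a).comp (taylor 1) from LinearMap.congr_fun h p
  refine Polynomial.lhom_ext' fun n => LinearMap.ext_ring ?_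
  simp only [LinearMap.comp_apply, LinearMap.mulLeft_apply, monomial_one_right_eq_X_pow,
    taylor_X_pow, map_one]
  rw [add_mul, one_mul, ← pow_succ', map_add, momentFunctional_X_pow, momentFunctional_X_pow, ha,
    momentFunctional_eq_sum (n := n + 1), Finset.sum_range_succ]
  · simp [coeff_X_add_one_pow]
  · have : (X + 1 : ℤ[X]) ^ n = (X + C 1) ^ n := by simp
    rw [this, (monic_X_add_C (1 : ℤ)).natDegree_pow, natDegree_X_add_C]
    omega

open Polynomial in
/-- The Charlier polynomials of parameter `1`, evaluated at `X + 1`. -/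
noncomputable def charlierShifted : ℕ → ℤ[X]
  | 0 => 1
  | n + 1 => (X + 1) * taylor (-1) (charlierShifted n) - charlierShifted n

open Polynomial in
theorem charlierShifted_monic (n : ℕ) :
    (charlierShifted n).Monic ∧ (charlierShifted n).natDegree = n := by
  induction n with
  | zero => simp [charlierShifted]
  | succ n ih =>
    obtain ⟨hm, hd⟩ := ih
    have hX : (X + 1 : ℤ[X]) = X + C 1 := by simp
    have hT : (taylor (-1) (charlierShifted n)).Monic := by
      rw [Monic, leadingCoeff_taylor, hm.leadingCoeff]
    have hM : ((X + 1) * taylor (-1) (charlierShifted n)).Monic := by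
      rw [hX]
      exact (monic_X_add_C 1).mul hT
    have hdeg : ((X + 1) * taylor (-1) (charlierShifted n)).natDegree = n + 1 := by
      rw [hX, (monic_X_add_C 1).natDegree_mul hT, natDegree_X_add_C, natDegree_taylor, hd,
        add_comm]
    have hlt : (charlierShifted n).natDegree <
        ((X + 1) * taylor (-1) (charlierShifted n)).natDegree := by omega
    rw [charlierShifted]
    exact ⟨hM.sub_of_left (degree_lt_degree hlt),
      (natDegree_sub_eq_left_of_natDegree_lt hlt).trans hdeg⟩

-- The shift by `1` undoes the `taylor (-1)` in the definition of `charlierShifted` and moves onto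
-- `q`.
open Polynomial in
theorem momentFunctional_charlierShifted_succ_mul {a : ℕ → ℤ}
    (ha : ∀ n, a (n + 1) = ∑ k ∈ Finset.range n, n.choose k * a k) (n : ℕ) (q : ℤ[X]) :
    momentFunctional a (charlierShifted (n + 1) * q) =
      momentFunctional a (charlierShifted n * (taylor 1 q - q)) := by
  rw [charlierShifted, sub_mul, mul_assoc, map_sub, momentFunctional_X_add_one_mul ha,
    taylor_mul, taylor_taylor, mul_sub, map_sub]
  simp

open Polynomial in
theorem taylor_one_X_pow_sub (n : ℕ) :
    taylor 1 (X ^ n : ℤ[X]) - X ^ n = ∑ k ∈ Finset.range n, (n.choose k : ℤ) • X ^ k := by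
  rw [taylor_X_pow, C_1, add_pow, Finset.sum_range_succ]
  simp [mul_comm]

open Polynomial in
theorem momentFunctional_charlierShifted_mul_X_pow {a : ℕ → ℤ} (h0 : a 0 = 1)
    (ha : ∀ n, a (n + 1) = ∑ k ∈ Finset.range n, n.choose k * a k) (n : ℕ) :
    (∀ j < n, momentFunctional a (charlierShifted n * X ^ j) = 0) ∧
      momentFunctional a (charlierShifted n * X ^ n) = n ! := by
  induction n with
  | zero =>
    refine ⟨by simp, ?_⟩
    rw [charlierShifted, one_mul, momentFunctional_X_pow, h0]
    simp
  | succ n ih =>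
    have hrec : ∀ j, momentFunctional a (charlierShifted (n + 1) * X ^ j) =
        ∑ k ∈ Finset.range j, (j.choose k : ℤ) *
          momentFunctional a (charlierShifted n * X ^ k) := by
      intro j
      rw [momentFunctional_charlierShifted_succ_mul ha, taylor_one_X_pow_sub, Finset.mul_sum,
        map_sum]
      simp only [mul_smul_comm, map_smul, smul_eq_mul]
    refine ⟨fun j hj => ?_, ?_⟩
    · rw [hrec]
      refine Finset.sum_eq_zero fun k hk => ?_
      rw [ih.1 k (by have := Finset.mem_range.1 hk; omega), mul_zero]
    · rw [hrec, Finset.sum_range_succ, ih.2, Finset.sum_eq_zero, zero_add,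
        Nat.choose_succ_self_right, Nat.factorial_succ, Nat.cast_mul]
      intro k hk
      rw [ih.1 k (Finset.mem_range.1 hk), mul_zero]

/-! ### Evaluation of the determinant -/

theorem hankelTransform_eq_superfactorial {a : ℕ → ℤ} (h0 : a 0 = 1)
    (ha : ∀ n, a (n + 1) = ∑ k ∈ Finset.range n, n.choose k * a k) (n : ℕ) :
    hankelTransform a n = ∏ i ∈ Finset.range (n + 1), (i ! : ℤ) := by
  let A : Matrix (Fin (n + 1)) (Fin (n + 1)) ℤ :=
    Matrix.of fun i j => (charlierShifted i).coeff j
  have hentry : ∀ i j, (A * hankelMatrix a n) i j =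
      momentFunctional a (charlierShifted i * Polynomial.X ^ (j : ℕ)) := by
    intro i j
    have hlin : momentFunctional a (charlierShifted i * Polynomial.X ^ (j : ℕ)) =
        momentFunctional (fun k => a (k + j)) (charlierShifted i) := by
      suffices h : (momentFunctional a).comp (LinearMap.mulRight ℤ (Polynomial.X ^ (j : ℕ))) =
          momentFunctional (fun k => a (k + j)) from LinearMap.congr_fun h _
      refine Polynomial.lhom_ext' fun m => LinearMap.ext_ring ?_
      simp only [LinearMap.comp_apply, LinearMap.mulRight_apply,
        Polynomial.monomial_one_right_eq_X_pow]
      rw [← pow_add, momentFunctional_X_pow, momentFunctional_X_pow]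
    have hdeg : (charlierShifted i).natDegree < n + 1 := by
      rw [(charlierShifted_monic i).2]
      exact i.2
    rw [hlin, momentFunctional_eq_sum _ hdeg, Finset.sum_range, Matrix.mul_apply]
    rfl
  have hdetA : A.det = 1 := by
    rw [Matrix.det_of_isLowerTriangular]
    · refine Finset.prod_eq_one fun i _ => ?_
      obtain ⟨hm, hd⟩ := charlierShifted_monic i
      have := hm.coeff_natDegree
      rwa [hd] at this
    · intro i j hij
      refine Polynomial.coeff_eq_zero_of_natDegree_lt ?_
      rw [(charlierShifted_monic i).2]
      exact hij
  have hdet : (A * hankelMatrix a n).det = ∏ i ∈ Finset.range (n + 1), (i ! : ℤ) := by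
    rw [Matrix.det_of_isUpperTriangular, Finset.prod_range]
    · refine Finset.prod_congr rfl fun i _ => ?_
      rw [hentry, (momentFunctional_charlierShifted_mul_X_pow h0 ha i).2]
    · intro i j hij
      rw [hentry, (momentFunctional_charlierShifted_mul_X_pow h0 ha i).1 j hij]
  rw [← hdet, Matrix.det_mul, hdetA, one_mul, hankelTransform]

theorem mainTheorem2 (n : ℕ) :
    hankelTransform (fun k => (associatedBell 2 k : ℤ)) n =
      ∏ i ∈ Finset.range (n + 1), (i ! : ℤ) := by
  refine hankelTransform_eq_superfactorial ?_ (fun m => ?_) n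
  · simp [associatedBell_two_zero]
  · simp only [associatedBell_two_succ]
    push_cast
    rfl
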